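/- Let $\mathcal X$ be a countable state space, $\Delta(\mathcal X)$ the set of probability distributions on $\mathcal X$, and $\mathcal X^*$ the set of finite sequences over $\mathcal X$. Let $f^\star\colon\mathcal X^*\to\Delta(\mathcal X)$ be an (unknown) environment, and let $\hat f,\hat f^{\mathrm{ref}}\colon\mathcal X^*\to\Delta(\mathcal X)$ be a model and a reference model. Let $(X_t)_{t\ge 1}$ be the stochastic process defined by $f^\star$, that is, $X_t\sim Y^\star_t=f^\star(X_1,\dots,X_{t-1})$ given $X_1,\dots,X_{t-1}$, and put $\hat Y_t=\hat f(X_1,\dots,X_{t-1})$ and $\hat Y^{\mathrm{ref}}_t=\hat f^{\mathrm{ref}}(X_1,\dots,X_{t-1})$. Let $\ell\colon\Delta(\mathcal X)\times\mathcal X\to[a,b]$ be a bounded scoring rule and let $\delta\in(0,1)$. The average expected score of $y_1,y^\star_1,\dots,y_t,y^\star_t$ is $$E^\ell(y_1,y^\star_1,\dots,y_t,y^\star_t)=\frac1t\sum_{i=1}^t\mathbb E_{X\sim y^\star_i}\,\ell(y_i,X).$$ The differential monitor $\mathbf M^D_{\ell,\delta}$ starts with $t=0$, $\hat E=0$, $N=1$,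 $\sigma=2(b-a)$. On each input $(\hat y,\hat y^{\mathrm{ref}},x)\in\Delta(\mathcal X)\times\Delta(\mathcal X)\times\mathcal X$ it sets $s\leftarrow\ell(\hat y,x)-\ell(\hat y^{\mathrm{ref}},x)$, then $t\leftarrow t+1$, then $N\leftarrow\max(1,N+(s-\hat E)^2)$, then $\hat E\leftarrow\frac1t\big((t-1)\hat E+s\big)$, and returns $[\hat E-\varepsilon,\hat E+\varepsilon]$, where $n=\max(e,N)$ and $$\varepsilon=\frac{\sqrt{2.13\,n\,g+1.76\,\sigma^2g^2}+1.33\,\sigma\,g}{t},\qquad g=2\log\!\Big(\frac{\pi\log n}{\sqrt6}\Big)+\log\frac2\delta .$$ Then, with probability at least $1-\delta$, for all $t\ge1$ simultaneously, the interval that $\mathbf M^D_{\ell,\delta}$ returns after reading $(\hat Y_1,\hat Y^{\mathrm{ref}}_1,X_1),\dots,(\hat Y_t,\hat Y^{\mathrm{ref}}_t,X_t)$ contains $$E^\ell(\hat Y_1,Y^\star_1,\dots,\hat Y_t,Y^\star_t)-E^\ell(\hat Y^{\mathrm{ref}}_1,Y^\star_1,\dots,\hat Y^{\mathrm{ref}}_t,Y^\star_t).$$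 Moreover, on a machine with unit-cost real arithmetic in which one evaluation of $\ell$ takes at most $T_{\ell,\mathcal X}\ge1$ steps, each iteration of the monitor takes at most $C\cdot T_{\ell,\mathcal X}$ steps and, apart from the evaluation of $\ell$ itself, occupies at most $C$ memory cells, where $C$ is a universal constant (in particular independent of the history and of $\mathcal X$). -/

import Mathlib

open MeasureTheory

noncomputable section

namespace AlignmentMonitoring

/-! ## Environment, models, and the two processes

`PMF X` is the set `Δ(X)` of probability distributions over the countable state space `X`, and
`List X` is the set `X*` of finite sequences.  Times are shifted by one: `Z i` is the state
observed at time `i + 1`. -/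

/-- The first `t` observed states, as a finite sequence. -/
def history {X Ω : Type*} (Z : ℕ → Ω → X) (t : ℕ) (ω : Ω) : List X :=
  (List.range t).map fun i => Z i ω

/-- `Z` is the stochastic process defined by the environment `env` under the probability `μ`:
given any finite history, the next state is sampled from the distribution that `env` assigns
to this history. -/
structure IsGeneratedBy {X Ω : Type*} [MeasurableSpace X] [MeasurableSpace Ω]
    (env : List X → PMF X) (μ : Measure Ω) (Z : ℕ → Ω → X) : Prop where
  measurable : ∀ t, Measurable (Z t)
  law : ∀ (t : ℕ) (h : List X) (x : X),
    μ {ω | history Z t ω = h ∧ Z t ω = x} = μ {ω | history Z t ω = h} * env h x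

/-- One element of the hidden history: the prediction of the model, the prediction of the
reference model, and the distribution of the environment. -/
structure Hidden (X : Type*) where
  model : PMF X
  ref : PMF X
  env : PMF X

/-- One element of the observed history: the prediction of the model, the prediction of the
reference model, and the observed state. -/
structure Observed (X : Type*) where
  model : PMF X
  ref : PMF X
  state : X

/-- The hidden history at time `t`. -/
def hiddenHistory {X Ω : Type*} (env model ref : List X → PMF X) (Z : ℕ → Ω → X)
    (t : ℕ) (ω : Ω) : List (Hidden X) :=
  (List.range t).map fun i =>
    ⟨model (history Z i ω), ref (history Z i ω), env (history Z i ω)⟩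

/-- The observed history at time `t`. -/
def observedHistory {X Ω : Type*} (model ref : List X → PMF X) (Z : ℕ → Ω → X)
    (t : ℕ) (ω : Ω) : List (Observed X) :=
  (List.range t).map fun i =>
    ⟨model (history Z i ω), ref (history Z i ω), Z i ω⟩

/-! ## The differential alignment monitoring problem -/

/-- The difference of the alignment scores `d` of the model and of the reference model. -/
def scoreDifference {X : Type*} (d : List (PMF X × PMF X) → ℝ) (v : List (Hidden X)) : ℝ :=
  d (v.map fun h => (h.model, h.env)) - d (v.map fun h => (h.ref, h.env))

/-- The monitor `M` is sound for the process `Z`: with probability at least `1 - δ`, at all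
times `t ≥ 1` simultaneously, the interval that `M` computes from the observed history contains
the difference of the alignment scores evaluated over the hidden history. -/
def SolvesDifferentialMonitoring {X Ω : Type*} [MeasurableSpace Ω] (μ : Measure Ω)
    (env model ref : List X → PMF X) (Z : ℕ → Ω → X) (d : List (PMF X × PMF X) → ℝ) (δ : ℝ)
    (M : List (Observed X) → Set ℝ) : Prop :=
  ENNReal.ofReal (1 - δ) ≤
    μ {ω | ∀ t : ℕ, 1 ≤ t →
      scoreDifference d (hiddenHistory env model ref Z t ω) ∈
        M (observedHistory model ref Z t ω)}

/-- The average expected score (AES) of a finite sequence of pairs (prediction, true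
distribution), with respect to the scoring rule `ℓ`. -/
def averageExpectedScore {X : Type*} [MeasurableSpace X] (ℓ : PMF X → X → ℝ)
    (v : List (PMF X × PMF X)) : ℝ :=
  (1 / (v.length : ℝ)) * (v.map fun p => ∫ x, ℓ p.1 x ∂p.2.toMeasure).sum

/-! ## A real random access machine with a scoring oracle

Programs are sequences of assignments of arithmetic expressions to registers.  Every access to
a constant or a register, every arithmetic operation and every assignment takes one step.  The
current input `(ŷ, ŷʳᵉᶠ, x)` is read-only and is accessed only by evaluating the scoring rule on
`(ŷ, x)` or on `(ŷʳᵉᶠ, x)`; the time of such an evaluation is charged in full. -/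

/-- The two evaluations of the scoring rule that are available on the current input. -/
inductive Query where
  | model
  | reference

/-- Registers are numbered, and each holds one real number. -/
abbrev Reg := ℕ

/-- Arithmetic expressions. -/
inductive Expr where
  | lit (r : ℝ)
  | reg (v : Reg)
  | score (q : Query)
  | add (e₁ e₂ : Expr)
  | sub (e₁ e₂ : Expr)
  | mul (e₁ e₂ : Expr)
  | div (e₁ e₂ : Expr)
  | max (e₁ e₂ : Expr)
  | sqrt (e : Expr)
  | log (e : Expr)

instance : Add Expr := ⟨Expr.add⟩
instance : Sub Expr := ⟨Expr.sub⟩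
instance : Mul Expr := ⟨Expr.mul⟩
instance : Div Expr := ⟨Expr.div⟩

namespace Expr

/-- The value of an expression, given the oracle answers and the register contents. -/
def eval (oracle : Query → ℝ) (mem : Reg → ℝ) : Expr → ℝ
  | lit r => r
  | reg v => mem v
  | score q => oracle q
  | add e₁ e₂ => eval oracle mem e₁ + eval oracle mem e₂
  | sub e₁ e₂ => eval oracle mem e₁ - eval oracle mem e₂
  | mul e₁ e₂ => eval oracle mem e₁ * eval oracle mem e₂
  | div e₁ e₂ => eval oracle mem e₁ / eval oracle mem e₂
  | max e₁ e₂ => Max.max (eval oracle mem e₁) (eval oracle mem e₂)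
  | sqrt e => Real.sqrt (eval oracle mem e)
  | log e => Real.log (eval oracle mem e)

/-- The number of steps that the evaluation takes, given the costs of the oracle calls. -/
def time (cost : Query → ℕ) : Expr → ℕ
  | lit _ => 1
  | reg _ => 1
  | score q => cost q
  | add e₁ e₂ => time cost e₁ + time cost e₂ + 1
  | sub e₁ e₂ => time cost e₁ + time cost e₂ + 1
  | mul e₁ e₂ => time cost e₁ + time cost e₂ + 1
  | div e₁ e₂ => time cost e₁ + time cost e₂ + 1
  | max e₁ e₂ => time cost e₁ + time cost e₂ + 1
  | sqrt e => time cost e + 1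
  | log e => time cost e + 1

/-- The number of temporary cells that the evaluation occupies: the operands are evaluated from
left to right, and the first result is kept while the second operand is evaluated. -/
def temps : Expr → ℕ
  | lit _ => 1
  | reg _ => 1
  | score _ => 1
  | add e₁ e₂ => Max.max (temps e₁) (temps e₂ + 1)
  | sub e₁ e₂ => Max.max (temps e₁) (temps e₂ + 1)
  | mul e₁ e₂ => Max.max (temps e₁) (temps e₂ + 1)
  | div e₁ e₂ => Max.max (temps e₁) (temps e₂ + 1)
  | max e₁ e₂ => Max.max (temps e₁) (temps e₂ + 1)
  | sqrt e => temps e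
  | log e => temps e

/-- The registers that the expression reads. -/
def regs : Expr → Finset Reg
  | lit _ => ∅
  | reg v => {v}
  | score _ => ∅
  | add e₁ e₂ => regs e₁ ∪ regs e₂
  | sub e₁ e₂ => regs e₁ ∪ regs e₂
  | mul e₁ e₂ => regs e₁ ∪ regs e₂
  | div e₁ e₂ => regs e₁ ∪ regs e₂
  | max e₁ e₂ => regs e₁ ∪ regs e₂
  | sqrt e => regs e
  | log e => regs e

end Expr

/-- The assignment `dst ← rhs`. -/
structure Assign where
  dst : Reg
  rhs : Expr

/-- A configuration of the machine, together with the resources used so far. -/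
structure Config where
  /-- the contents of the registers -/
  mem : Reg → ℝ
  /-- the registers that have been occupied since the start of the monitor -/
  used : Finset Reg
  /-- the number of steps of the current iteration -/
  time : ℕ
  /-- the peak number of occupied cells (registers and temporaries) in the current iteration -/
  space : ℕ

/-- The execution of one assignment. -/
def Config.step (oracle : Query → ℝ) (cost : Query → ℕ) (c : Config) (s : Assign) : Config where
  mem := Function.update c.mem s.dst (s.rhs.eval oracle c.mem)
  used := insert s.dst (c.used ∪ s.rhs.regs)
  time := c.time + s.rhs.time cost + 1
  space := max c.space ((insert s.dst (c.used ∪ s.rhs.regs)).card + s.rhs.temps)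

/-- The execution of a program as one iteration: the registers persist from the previous
iteration, and the resource counters of the iteration start at zero. -/
def Config.iterate (oracle : Query → ℝ) (cost : Query → ℕ) (prog : List Assign) (c : Config) :
    Config :=
  prog.foldl (Config.step oracle cost) { c with time := 0, space := 0 }

/-! ## The differential alignment monitor -/

/-- time `t` -/
abbrev rT : Reg := 0
/-- running average `Ê` of the score differences -/
abbrev rE : Reg := 1
/-- empirical variance `N` -/
abbrev rN : Reg := 2
/-- range `σ` -/
abbrev rSigma : Reg := 3
/-- error probability `δ` -/
abbrev rDelta : Reg := 4
/-- current score difference `s` -/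
abbrev rS : Reg := 5
/-- clamped empirical variance `n` -/
abbrev rClamp : Reg := 6
/-- `g(n, δ)` -/
abbrev rG : Reg := 7
/-- `ε_t(n, δ, σ)` -/
abbrev rEps : Reg := 8
/-- lower end of the returned interval -/
abbrev rLo : Reg := 9
/-- upper end of the returned interval -/
abbrev rHi : Reg := 10

/-- `Init`: `t ← 0`, `Ê ← 0`, `N ← 1`, `σ ← 2 (b - a)`; the parameter `δ` is stored as well. -/
def initConfig (a b δ : ℝ) : Config where
  mem := fun r =>
    if r = rT then 0 else if r = rE then 0 else if r = rN then 1
    else if r = rSigma then 2 * (b - a) else if r = rDelta then δ else 0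
  used := {rT, rE, rN, rSigma, rDelta}
  time := 0
  space := 5

open AlignmentMonitoring.Expr in
/-- `Next`. -/
def nextProgram : List Assign :=
  [ -- s ← ℓ(ŷ, x) - ℓ(ŷʳᵉᶠ, x)
    ⟨rS, score Query.model - score Query.reference⟩,
    -- t ← t + 1
    ⟨rT, reg rT + lit 1⟩,
    -- N ← max(1, N + (s - Ê)²)
    ⟨rN, .max (lit 1) (reg rN + (reg rS - reg rE) * (reg rS - reg rE))⟩,
    -- Ê ← (1 / t) ((t - 1) Ê + s)
    ⟨rE, lit 1 / reg rT * ((reg rT - lit 1) * reg rE + reg rS)⟩,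
    -- n ← max(e, N)
    ⟨rClamp, .max (lit (Real.exp 1)) (reg rN)⟩,
    -- g ← 2 log(π log(n) / √6) + log(2 / δ)
    ⟨rG, lit 2 * log (lit Real.pi * log (reg rClamp) / sqrt (lit 6)) + log (lit 2 / reg rDelta)⟩,
    -- ε ← (√(2.13 n g + 1.76 σ² g²) + 1.33 σ g) / t
    ⟨rEps, (sqrt (lit 2.13 * reg rClamp * reg rG +
        lit 1.76 * (reg rSigma * reg rSigma) * (reg rG * reg rG)) +
        lit 1.33 * reg rSigma * reg rG) / reg rT⟩,
    -- return [Ê - ε, Ê + ε]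
    ⟨rLo, reg rE - reg rEps⟩,
    ⟨rHi, reg rE + reg rEps⟩ ]

/-- A number depending on `(ŷ, x)`, read off for both predictions of the current input. -/
def onInput {X α : Type*} (f : PMF X → X → α) (w : Observed X) : Query → α
  | .model => f w.model w.state
  | .reference => f w.ref w.state

/-- The configuration of the monitor after the observed history `w`.  Its counters `time` and
`space` refer to the last iteration.  An evaluation of the scoring rule `ℓ` on `(y, x)` takes
`τ y x` steps. -/
def monitorConfig {X : Type*} (ℓ : PMF X → X → ℝ) (τ : PMF X → X → ℕ) (a b δ : ℝ)
    (w : List (Observed X)) : Config :=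
  w.foldl (fun c o => c.iterate (onInput ℓ o) (onInput τ o) nextProgram) (initConfig a b δ)

/-- The differential alignment monitor: the interval returned after the observed history `w`. -/
def diffMonitor {X : Type*} (ℓ : PMF X → X → ℝ) (τ : PMF X → X → ℕ) (a b δ : ℝ)
    (w : List (Observed X)) : Set ℝ :=
  Set.Icc ((monitorConfig ℓ τ a b δ w).mem rLo) ((monitorConfig ℓ τ a b δ w).mem rHi)

end AlignmentMonitoring

end

/-!
Along the process `X_1, X_2, …`, let `s_i` be the difference of the scores that the two models obtain
on `X_i`, let `m_i` be its conditional mean and let `e_i` be the average of the earlier differences.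
Then `t` times the monitored quantity is `∑ m_i`, and the monitor returns an interval around the
average of the `s_i`, so soundness is a bound on the martingale `D_t = ∑ (s_i - m_i)` in terms of the
empirical variance `V_t = ∑ (s_i - e_i)²`, uniformly in time.

Since `s_i - e_i ≥ -c` for `c = 2 (b - a)`, Fan's inequality (`exp_sub_sq_le_one_add`) bounds
`exp (l (s_i - e_i) - ψ(l) (s_i - e_i)²)` by `1 + l (s_i - e_i)`, where `ψ(l) = l² / (2 (1 - l c))`.
Taking expectations shows that `exp (l D_t - ψ(l) V_t)` is a supermartingale, and Ville's inequality
gives `l D_t - ψ(l) V_t < L` for all `t`, up to probability `exp (-L)`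
(`IsGeneratedBy.measure_line_crossing_le`).

For a curved boundary, one such line is used for each epoch `e ^ (k + 1) ≤ n ≤ e ^ (k + 2)` of the
clamped variance `n`, with error probability proportional to `1 / (k + 1)²`; as `k + 1 ≤ log n`, the
logarithm of its inverse is at most the quantity `g` of the monitor. The line is tangent to the optimal boundary at
the geometric mean of the epoch, and within the epoch it loses only a constant factor, which the
constant `2.13` absorbs (`le_of_line`). The union bound over the epochs and over both signs gives the
error probability `δ`.

The state space is countable, so processes are treated as functions on the tree `List X` of histories,
and Ville's inequality is proved there by induction on the horizon, using the law of the process only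
through the probabilities of finite histories. The resource bounds hold because the program is a
fixed list of assignments to eleven registers.
-/

open scoped ENNReal

namespace AlignmentMonitoring

/-! ### Additive functionals of a history -/

section PathSum
variable {X : Type*}

/-- The sum of `f h x` over all ways of writing the given history as `h ++ [x] ++ _`: the value
after `X_1, …, X_t` of the additive process with increments `f (X_1, …, X_{i-1}) X_i`. -/
noncomputable def pathSum (f : List X → X → ℝ) (h : List X) : ℝ :=
  h.reverseRecOn 0 fun h x r => r + f h x

@[simp] theorem pathSum_nil (f : List X → X → ℝ) : pathSum f [] = 0 := by
  simp [pathSum]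

@[simp] theorem pathSum_concat (f : List X → X → ℝ) (h : List X) (x : X) :
    pathSum f (h ++ [x]) = pathSum f h + f h x := by
  simp [pathSum]

theorem pathSum_neg (f : List X → X → ℝ) (h : List X) :
    pathSum (fun h x => -f h x) h = -pathSum f h := by
  induction h using List.reverseRecOn with
  | nil => simp
  | append_singleton h x ih => simp [ih]; ring

theorem abs_pathSum_le {f : List X → X → ℝ} {R : ℝ} (hf : ∀ h x, |f h x| ≤ R) (h : List X) :
    |pathSum f h| ≤ h.length * R := by
  induction h using List.reverseRecOn with
  | nil => simp
  | append_singleton h x ih =>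
    have := abs_add_le (pathSum f h) (f h x)
    have := hf h x
    simp only [pathSum_concat, List.length_append, List.length_singleton]
    push_cast
    linarith

theorem pathSum_nonneg {f : List X → X → ℝ} (hf : ∀ h x, 0 ≤ f h x) (h : List X) :
    0 ≤ pathSum f h := by
  induction h using List.reverseRecOn with
  | nil => simp
  | append_singleton h x ih => rw [pathSum_concat]; exact add_nonneg ih (hf h x)

/-- The average increment; it is `0 / 0 = 0` on the empty history, which is also the initial value
of `Ê` in the monitor. -/
noncomputable def pathMean (f : List X → X → ℝ) (h : List X) : ℝ :=
  pathSum f h / h.length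

theorem abs_pathMean_le {f : List X → X → ℝ} {R : ℝ} (hR : 0 ≤ R) (hf : ∀ h x, |f h x| ≤ R)
    (h : List X) : |pathMean f h| ≤ R := by
  rcases Nat.eq_zero_or_pos h.length with h0 | h0
  · simpa [pathMean, h0] using hR
  · have : (0 : ℝ) < h.length := by exact_mod_cast h0
    rw [pathMean, abs_div, abs_of_pos this, div_le_iff₀ this, mul_comm]
    exact abs_pathSum_le hf h

/-- The sum of the squared errors of the predictions `e` of the increments `s`, where `e` sees only
the history before the increment. -/
noncomputable def empVar (s : List X → X → ℝ) (e : List X → ℝ) (h : List X) : ℝ :=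
  pathSum (fun h x => (s h x - e h) ^ 2) h

/-- The martingale `∑ (s_i - E[s_i | X_1, …, X_{i-1}])`, as a function of the history. -/
noncomputable def deviation [MeasurableSpace X] (env : List X → PMF X) (s : List X → X → ℝ)
    (h : List X) : ℝ :=
  pathSum (fun h x => s h x - ∫ y, s h y ∂(env h).toMeasure) h

theorem deviation_neg [MeasurableSpace X] (env : List X → PMF X) (s : List X → X → ℝ) (h : List X) :
    deviation env (fun h x => -s h x) h = -deviation env s h := by
  simp only [deviation, ← pathSum_neg]
  congr! 3
  rw [integral_neg]
  ring

end PathSum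

/-! ### Ville's inequality on the tree of histories -/

section Ville
variable {X Ω : Type*}

theorem history_zero (Z : ℕ → Ω → X) (ω : Ω) : history Z 0 ω = [] := rfl

theorem history_succ (Z : ℕ → Ω → X) (t : ℕ) (ω : Ω) :
    history Z (t + 1) ω = history Z t ω ++ [Z t ω] := by
  simp [history, List.range_succ]

theorem length_history (Z : ℕ → Ω → X) (t : ℕ) (ω : Ω) : (history Z t ω).length = t := by
  simp [history]

variable [MeasurableSpace X] [MeasurableSpace Ω]
  {μ : Measure Ω} {env : List X → PMF X} {Z : ℕ → Ω → X}

theorem IsGeneratedBy.measure_history_concat (hZ : IsGeneratedBy env μ Z) (t : ℕ) (h : List X)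
    (x : X) : μ {ω | history Z (t + 1) ω = h ++ [x]} = μ {ω | history Z t ω = h} * env h x := by
  rw [← hZ.law]
  congr 1
  ext ω
  simp [history_succ]

variable [Countable X]

/-- Ville's inequality with horizon `n`, started at the history `h`. The induction on `n` decomposes
according to the next state and uses only countable subadditivity, so that no measurability of
events about histories is needed. -/
theorem IsGeneratedBy.measure_crossing_mul_le (hZ : IsGeneratedBy env μ Z) {W : List X → ℝ≥0∞}
    (hW : ∀ h, ∑' x, env h x * W (h ++ [x]) ≤ W h) (K : ℝ≥0∞) (n : ℕ) :
    ∀ (m : ℕ) (h : List X),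
      μ {ω | history Z m ω = h ∧ ∃ j ≤ n, K ≤ W (history Z (m + j) ω)} * K ≤
        μ {ω | history Z m ω = h} * W h := by
  induction n with
  | zero =>
    intro m h
    by_cases hK : K ≤ W h
    · gcongr
      exact fun hω => hω.1
    · have : {ω | history Z m ω = h ∧ ∃ j ≤ 0, K ≤ W (history Z (m + j) ω)} = ∅ := by
        ext ω
        simp only [Set.mem_ofPred_eq, Set.mem_empty_iff_false, iff_false, not_and]
        rintro rfl ⟨j, hj, h'⟩
        obtain rfl : j = 0 := by omega
        exact hK h'
      rw [this]
      simp
  | succ n ih =>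
    intro m h
    by_cases hK : K ≤ W h
    · gcongr
      exact fun hω => hω.1
    · have hsub : {ω | history Z m ω = h ∧ ∃ j ≤ n + 1, K ≤ W (history Z (m + j) ω)} ⊆
          ⋃ x, {ω | history Z (m + 1) ω = h ++ [x] ∧
            ∃ j ≤ n, K ≤ W (history Z (m + 1 + j) ω)} := by
        rintro ω ⟨rfl, j, hj, h'⟩
        refine Set.mem_iUnion.2 ⟨Z m ω, history_succ Z m ω, ?_⟩
        rcases j with _ | j
        · exact absurd h' hK
        · exact ⟨j, by omega, by rwa [add_right_comm, add_assoc]⟩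
      calc μ {ω | history Z m ω = h ∧ ∃ j ≤ n + 1, K ≤ W (history Z (m + j) ω)} * K
          ≤ (∑' x, μ {ω | history Z (m + 1) ω = h ++ [x] ∧
            ∃ j ≤ n, K ≤ W (history Z (m + 1 + j) ω)}) * K := by
            gcongr
            exact (measure_mono hsub).trans (measure_iUnion_le _)
        _ = ∑' x, μ {ω | history Z (m + 1) ω = h ++ [x] ∧
            ∃ j ≤ n, K ≤ W (history Z (m + 1 + j) ω)} * K := ENNReal.tsum_mul_right.symm
        _ ≤ ∑' x, μ {ω | history Z m ω = h} * (env h x * W (h ++ [x])) := by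
            refine ENNReal.tsum_le_tsum fun x => (ih (m + 1) (h ++ [x])).trans_eq ?_
            rw [hZ.measure_history_concat, mul_assoc]
        _ = μ {ω | history Z m ω = h} * ∑' x, env h x * W (h ++ [x]) := ENNReal.tsum_mul_left
        _ ≤ _ := by gcongr; exact hW h

/-- Ville's inequality: a nonnegative supermartingale `W` ever reaches `K` with probability at most
`W [] / K`. -/
theorem IsGeneratedBy.measure_exists_le_mul_le [IsProbabilityMeasure μ]
    (hZ : IsGeneratedBy env μ Z) {W : List X → ℝ≥0∞}
    (hW : ∀ h, ∑' x, env h x * W (h ++ [x]) ≤ W h) (K : ℝ≥0∞) :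
    μ {ω | ∃ t, K ≤ W (history Z t ω)} * K ≤ W [] := by
  have hU : {ω | ∃ t, K ≤ W (history Z t ω)} =
      ⋃ n, {ω | ∃ j ≤ n, K ≤ W (history Z j ω)} := by
    ext ω
    simp only [Set.mem_ofPred_eq, Set.mem_iUnion]
    exact ⟨fun ⟨t, ht⟩ => ⟨t, t, le_rfl, ht⟩, fun ⟨_, t, _, ht⟩ => ⟨t, ht⟩⟩
  have hmono : Monotone fun n : ℕ => {ω | ∃ j ≤ n, K ≤ W (history Z j ω)} :=
    fun n n' hn ω ⟨j, hj, h⟩ => ⟨j, hj.trans hn, h⟩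
  rw [hU, hmono.measure_iUnion, ENNReal.iSup_mul]
  refine iSup_le fun n => ?_
  simpa [history_zero] using hZ.measure_crossing_mul_le hW K n 0 []

end Ville

/-! ### The exponential supermartingale -/

section Exponential

/-- For negative `x`, put `z = (1 + x)⁻¹ ≥ 1`; the claim is then implied by
`log z ≤ sinh (log z) = (z - z⁻¹) / 2`. -/
theorem sub_sq_le_log_one_add {x u : ℝ} (hu0 : 0 ≤ u) (hu : u < 1) (hx : -u ≤ x) :
    x - x ^ 2 / (2 * (1 - u)) ≤ Real.log (1 + x) := by
  rcases le_total 0 x with h0 | h0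
  · calc x - x ^ 2 / (2 * (1 - u)) ≤ x - x ^ 2 / 2 := by
          gcongr
          linarith
      _ ≤ 2 * x / (x + 2) := by
          rw [le_div_iff₀ (by positivity)]
          nlinarith [pow_nonneg h0 3]
      _ ≤ Real.log (1 + x) := Real.le_log_one_add_of_nonneg h0
  · have h1 : 0 < 1 + x := by linarith
    have h2 : -Real.log (1 + x) ≤ Real.sinh (-Real.log (1 + x)) :=
      Real.self_le_sinh_iff.2 (neg_nonneg.2 (Real.log_nonpos h1.le (by linarith)))
    rw [Real.sinh_neg, Real.sinh_log h1] at h2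
    calc x - x ^ 2 / (2 * (1 - u)) ≤ x - x ^ 2 / (2 * (1 + x)) := by
          gcongr
          linarith
      _ = (1 + x - (1 + x)⁻¹) / 2 := by field_simp; ring
      _ ≤ _ := by linarith

/-- Fan's inequality with the sub-gamma function `l ^ 2 / (2 (1 - l c))`: a quadratic correction by
the observed square makes the exponential linear, and this holds pointwise. -/
theorem exp_sub_sq_le_one_add {y c l : ℝ} (hl : 0 ≤ l) (hc0 : 0 ≤ c) (hc : l * c < 1)
    (hy : -c ≤ y) :
    Real.exp (l * y - l ^ 2 / (2 * (1 - l * c)) * y ^ 2) ≤ 1 + l * y := by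
  have h1 : -(l * c) ≤ l * y := by nlinarith
  have h2 : 0 < 1 + l * y := by linarith
  rw [← Real.le_log_iff_exp_le h2]
  refine le_of_eq_of_le ?_ (sub_sq_le_log_one_add (mul_nonneg hl hc0) hc h1)
  ring

variable {X : Type*} [Countable X] [MeasurableSpace X] [MeasurableSingletonClass X]

theorem integrable_of_abs_le (p : PMF X) {f : X → ℝ} {R : ℝ} (hf : ∀ x, |f x| ≤ R) :
    Integrable f p.toMeasure :=
  Integrable.of_bound (measurable_of_countable f).aestronglyMeasurable R
    (Filter.Eventually.of_forall hf)

theorem tsum_mul_ofReal (p : PMF X) {f : X → ℝ} (hf : Integrable f p.toMeasure)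
    (h0 : ∀ x, 0 ≤ f x) :
    ∑' x, p x * ENNReal.ofReal (f x) = ENNReal.ofReal (∫ x, f x ∂p.toMeasure) := by
  rw [ofReal_integral_eq_lintegral_ofReal hf (Filter.Eventually.of_forall h0),
    lintegral_countable']
  refine tsum_congr fun x => ?_
  rw [PMF.toMeasure_apply_singleton _ _ (measurableSet_singleton x), mul_comm]

/-- One step of the supermartingale: the expectation of the linear bound is
`exp (l (e - m)) (1 + l (m - e)) ≤ 1` for the mean `m` of `f`. -/
theorem tsum_mul_exp_le_one (p : PMF X) {f : X → ℝ} {e R l : ℝ} (hf : ∀ x, |f x| ≤ R)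
    (he : |e| ≤ R) (hl : 0 ≤ l) (hlR : l * (2 * R) < 1) :
    ∑' x, p x * ENNReal.ofReal (Real.exp (l * (f x - ∫ y, f y ∂p.toMeasure) -
      l ^ 2 / (2 * (1 - l * (2 * R))) * (f x - e) ^ 2)) ≤ 1 := by
  set m := ∫ y, f y ∂p.toMeasure with hm
  have hint : Integrable f p.toMeasure := integrable_of_abs_le p hf
  have hlow : ∀ x, -(2 * R) ≤ f x - e := fun x => by
    have := abs_le.1 (hf x); have := abs_le.1 he; linarith
  have hnn : ∀ x, 0 ≤ 1 + l * (f x - e) := fun x => by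
    have := mul_le_mul_of_nonneg_left (hlow x) hl
    linarith
  calc _ ≤ ∑' x, p x * ENNReal.ofReal (Real.exp (l * (e - m)) * (1 + l * (f x - e))) := by
        refine ENNReal.tsum_le_tsum fun x => ?_
        gcongr
        refine le_trans (le_of_eq ?_) (mul_le_mul_of_nonneg_left
          (exp_sub_sq_le_one_add hl (by linarith [(abs_nonneg e).trans he]) hlR (hlow x))
          (Real.exp_nonneg _))
        rw [← Real.exp_add]
        ring_nf
    _ = ENNReal.ofReal (Real.exp (l * (e - m)) * (1 + l * (m - e))) := by
        rw [tsum_mul_ofReal p]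
        · have hsub : Integrable (fun x => l * (f x - e)) p.toMeasure :=
            (hint.sub (integrable_const _)).const_mul _
          rw [integral_const_mul, integral_add (integrable_const _) hsub, integral_const_mul,
            integral_sub hint (integrable_const _)]
          simp [hm]
        · exact ((integrable_const _).add
            ((hint.sub (integrable_const _)).const_mul _)).const_mul _
        · exact fun x => mul_nonneg (Real.exp_nonneg _) (hnn x)
    _ ≤ 1 := by
        rw [ENNReal.ofReal_le_one]
        have h1 := Real.add_one_le_exp (l * (m - e))
        calc _ ≤ Real.exp (l * (e - m)) * Real.exp (l * (m - e)) := by gcongr; linarith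
          _ = 1 := by rw [← Real.exp_add, ← Real.exp_zero]; ring_nf

variable {Ω : Type*} [MeasurableSpace Ω] {μ : Measure Ω} [IsProbabilityMeasure μ]
  {env : List X → PMF X} {Z : ℕ → Ω → X}

/-- A linear boundary with slope parameter `l` is ever crossed with probability at most `exp (-L)`. -/
theorem IsGeneratedBy.measure_line_crossing_le (hZ : IsGeneratedBy env μ Z)
    {s : List X → X → ℝ} {e : List X → ℝ} {R l : ℝ} (hs : ∀ h x, |s h x| ≤ R)
    (he : ∀ h, |e h| ≤ R) (hl : 0 ≤ l) (hlR : l * (2 * R) < 1) (L : ℝ) :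
    μ {ω | ∃ t, L ≤ l * deviation env s (history Z t ω) -
      l ^ 2 / (2 * (1 - l * (2 * R))) * empVar s e (history Z t ω)} ≤
        ENNReal.ofReal (Real.exp (-L)) := by
  have key := hZ.measure_exists_le_mul_le
    (W := fun h => ENNReal.ofReal (Real.exp (l * deviation env s h -
      l ^ 2 / (2 * (1 - l * (2 * R))) * empVar s e h))) (fun h => ?_)
      (ENNReal.ofReal (Real.exp L))
  · simp only [ENNReal.ofReal_le_ofReal_iff (Real.exp_nonneg _), Real.exp_le_exp] at key
    rw [Real.exp_neg, ENNReal.ofReal_inv_of_pos (Real.exp_pos L), ENNReal.le_inv_iff_mul_le]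
    simpa [deviation, empVar] using key
  · calc _ = ENNReal.ofReal (Real.exp (l * deviation env s h -
            l ^ 2 / (2 * (1 - l * (2 * R))) * empVar s e h)) *
          ∑' x, env h x * ENNReal.ofReal (Real.exp (l * (s h x - ∫ y, s h y ∂(env h).toMeasure) -
            l ^ 2 / (2 * (1 - l * (2 * R))) * (s h x - e h) ^ 2)) := by
          rw [← ENNReal.tsum_mul_left]
          refine tsum_congr fun x => ?_
          rw [mul_left_comm (ENNReal.ofReal _), ← ENNReal.ofReal_mul (Real.exp_nonneg _),
            ← Real.exp_add]
          simp only [deviation, empVar, pathSum_concat]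
          congr 3
          ring
      _ ≤ _ := mul_le_of_le_one_right' (tsum_mul_exp_le_one (env h) (hs h) (he h) hl hlR)

end Exponential

/-! ### Stitching the linear boundaries -/

section Stitching

/-- The line that is tangent to `√(2 n L) + c L` at `n = nbar` stays below `√(2.13 n L) + c L` as
long as `n` is within a factor `1.65 > √e` of `nbar`. The constant `2.13` comes from
`(√r + √r⁻¹)² / 2 = 1 + (r + r⁻¹) / 2` with `r = n / nbar`. -/
theorem le_of_line {L c n nbar D V : ℝ} (hL : 0 < L) (hc : 0 ≤ c) (hn : 0 < n)
    (hbar : 0 < nbar) (h1 : n ≤ 1.65 * nbar) (h2 : nbar ≤ 1.65 * n) (hV : V ≤ n) {l : ℝ}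
    (hl : l = 1 / (c + √(nbar / (2 * L))))
    (h : l * D - l ^ 2 / (2 * (1 - l * c)) * V ≤ L) :
    D ≤ √(2.13 * n * L) + c * L := by
  have hr : 0 < √(nbar / (2 * L)) := Real.sqrt_pos.2 (by positivity)
  have hr2 : √(nbar / (2 * L)) ^ 2 = nbar / (2 * L) := Real.sq_sqrt (by positivity)
  set r := √(nbar / (2 * L))
  have hlpos : 0 < l := by rw [hl]; positivity
  have hlc : 1 - l * c = l * r := by rw [hl]; field_simp; ring
  have hD : l * D ≤ l * (L * (c + r) + n / (2 * r)) := by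
    have e1 : l ^ 2 / (2 * (1 - l * c)) = l / (2 * r) := by rw [hlc]; field_simp
    have e2 : l * (c + r) = 1 := by rw [hl]; field_simp
    rw [e1] at h
    have : l / (2 * r) * V ≤ l / (2 * r) * n := by gcongr
    calc l * D ≤ L + l / (2 * r) * n := by linarith
      _ = L * (l * (c + r)) + l / (2 * r) * n := by rw [e2, mul_one]
      _ = _ := by ring
  have hD' := le_of_mul_le_mul_left hD hlpos
  have hsq : L * r + n / (2 * r) ≤ √(2.13 * n * L) := by
    apply Real.le_sqrt_of_sq_le
    have hx : nbar ^ 2 + n ^ 2 ≤ 2.26 * (n * nbar) := by nlinarith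
    calc (L * r + n / (2 * r)) ^ 2 = L ^ 2 * r ^ 2 + L * n + n ^ 2 / (4 * r ^ 2) := by
          field_simp; ring
      _ = L / (2 * nbar) * (nbar ^ 2 + n ^ 2) + L * n := by rw [hr2]; field_simp; ring
      _ ≤ L / (2 * nbar) * (2.26 * (n * nbar)) + L * n := by gcongr
      _ = 2.13 * n * L := by field_simp; ring
  linarith

/-- The quantity `g(n, δ)` of the monitor. -/
noncomputable def logTerm (δ n : ℝ) : ℝ :=
  2 * Real.log (Real.pi * Real.log n / √6) + Real.log (2 / δ)

/-- The quantity `t ε` of the monitor, for the range `c`, in the syntactic shape in which the program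
computes it. -/
noncomputable def radius (c δ n : ℝ) : ℝ :=
  √(2.13 * n * logTerm δ n + 1.76 * (c * c) * (logTerm δ n * logTerm δ n)) +
    1.33 * c * logTerm δ n

theorem logTerm_mono {δ m n : ℝ} (hm : 1 < m) (hmn : m ≤ n) : logTerm δ m ≤ logTerm δ n := by
  have := Real.log_pos hm
  unfold logTerm
  gcongr

/-- At the lower end `n = e ^ (k + 1)` of the `k`-th epoch, `g` is the logarithm of the inverse of the
error probability that is spent on this epoch. -/
theorem exp_neg_logTerm {δ : ℝ} (hδ : 0 < δ) (k : ℕ) :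
    Real.exp (-logTerm δ (Real.exp (k + 1))) = δ * (3 / Real.pi ^ 2) * (1 / ((k : ℝ) + 1) ^ 2) := by
  have hk : (0 : ℝ) < k + 1 := by positivity
  have hpi := Real.pi_pos
  have h6 : √(6 : ℝ) ^ 2 = 6 := Real.sq_sqrt (by norm_num)
  have : logTerm δ (Real.exp (k + 1)) = Real.log ((Real.pi * (k + 1) / √6) ^ 2 * (2 / δ)) := by
    rw [logTerm, Real.log_exp, Real.log_mul (by positivity) (by positivity), Real.log_pow]
    norm_num
  rw [this, Real.exp_neg, Real.exp_log (by positivity), div_pow, h6]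
  field_simp
  norm_num

theorem logTerm_exp_pos {δ : ℝ} (hδ : 0 < δ) (hδ1 : δ < 1) (k : ℕ) :
    0 < logTerm δ (Real.exp (k + 1)) := by
  rw [← neg_lt_zero, ← Real.exp_lt_one_iff, exp_neg_logTerm hδ]
  have h3 := Real.pi_gt_three
  have h1 : δ * (3 / Real.pi ^ 2) < 1 := by
    rw [← mul_div_assoc, div_lt_one (by positivity)]
    nlinarith
  have h2 : 1 / ((k : ℝ) + 1) ^ 2 ≤ 1 := by
    rw [div_le_one (by positivity)]
    nlinarith [(Nat.cast_nonneg k : (0 : ℝ) ≤ k)]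
  have h4 : (0 : ℝ) ≤ δ * (3 / Real.pi ^ 2) := by positivity
  nlinarith

/-- The epochs together spend `δ / 2`, because `∑ 1 / k ^ 2 = π ^ 2 / 6`. -/
theorem tsum_exp_neg_logTerm {δ : ℝ} (hδ : 0 < δ) :
    ∑' k : ℕ, ENNReal.ofReal (Real.exp (-logTerm δ (Real.exp (k + 1)))) =
      ENNReal.ofReal (δ / 2) := by
  have h := (hasSum_nat_add_iff' (f := fun n : ℕ => 1 / (n : ℝ) ^ 2) 1).2 hasSum_zeta_two
  have h' := h.mul_left (δ * (3 / Real.pi ^ 2))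
  simp only [exp_neg_logTerm hδ]
  rw [← ENNReal.ofReal_tsum_of_nonneg (fun k => by positivity)]
  · congr 1
    push_cast at h'
    rw [h'.tsum_eq]
    have := Real.pi_pos
    simp
    field_simp
    norm_num
  · exact_mod_cast h'.summable

variable {X : Type*} [Countable X] [MeasurableSpace X] [MeasurableSingletonClass X]
  {Ω : Type*} [MeasurableSpace Ω] {μ : Measure Ω} [IsProbabilityMeasure μ]
  {env : List X → PMF X} {Z : ℕ → Ω → X}

/-- The geometric mean of the end points of the epoch `[e ^ (k + 1), e ^ (k + 2)]`. -/
noncomputable def tangentPoint (k : ℕ) : ℝ := Real.exp (k + 3 / 2)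

theorem exists_tangentPoint {n : ℝ} (hn : Real.exp 1 ≤ n) :
    ∃ k : ℕ, Real.exp (k + 1) ≤ n ∧ n ≤ 1.65 * tangentPoint k ∧ tangentPoint k ≤ 1.65 * n := by
  have hn0 : 0 < n := (Real.exp_pos 1).trans_le hn
  have hlog : 1 ≤ Real.log n := (Real.le_log_iff_exp_le hn0).2 hn
  have hhalf : Real.exp (1 / 2) ≤ 1.65 := by
    have h : Real.exp (1 / 2) ^ 2 = Real.exp 1 := by rw [← Real.exp_nat_mul]; norm_num
    have := Real.exp_one_lt_d9
    refine le_of_sq_le_sq ?_ (by norm_num)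
    rw [h]
    norm_num at this ⊢
    linarith
  have hfl : 1 ≤ ⌊Real.log n⌋₊ := Nat.le_floor (by exact_mod_cast hlog)
  obtain ⟨k, hk⟩ : ∃ k, ⌊Real.log n⌋₊ = k + 1 := ⟨_, (Nat.sub_add_cancel hfl).symm⟩
  have h1 : (k : ℝ) + 1 ≤ Real.log n := by
    have := Nat.floor_le (zero_le_one.trans hlog)
    rw [hk] at this
    exact_mod_cast this
  have h2 : Real.log n ≤ k + 2 := by
    have := (Nat.lt_floor_add_one (Real.log n)).le
    rw [hk] at this
    push_cast at this
    linarith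
  have h1' : Real.exp (k + 1) ≤ n := (Real.le_log_iff_exp_le hn0).1 h1
  have h2' : n ≤ Real.exp (k + 2) := (Real.log_le_iff_le_exp hn0).1 h2
  refine ⟨k, h1', h2'.trans ?_, ?_⟩
  · calc Real.exp (k + 2) = Real.exp (1 / 2) * tangentPoint k := by
          rw [tangentPoint, ← Real.exp_add]; ring_nf
      _ ≤ _ := by unfold tangentPoint; gcongr
  · calc tangentPoint k = Real.exp (1 / 2) * Real.exp (k + 1) := by
          rw [tangentPoint, ← Real.exp_add]; ring_nf
      _ ≤ _ := by gcongr

/-- The one-sided empirical Bernstein bound, uniform in time. -/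
theorem IsGeneratedBy.measure_radius_lt_deviation_le (hZ : IsGeneratedBy env μ Z)
    {s : List X → X → ℝ} {e : List X → ℝ} {R δ : ℝ} (hR : 0 ≤ R) (hs : ∀ h x, |s h x| ≤ R)
    (he : ∀ h, |e h| ≤ R) (hδ : 0 < δ) (hδ1 : δ < 1) :
    μ {ω | ∃ t, radius (2 * R) δ (max (Real.exp 1) (1 + empVar s e (history Z t ω))) <
      deviation env s (history Z t ω)} ≤ ENNReal.ofReal (δ / 2) := by
  -- The slope on epoch `k` is optimal for empirical variance `tangentPoint k` and level `L k`.
  set L : ℕ → ℝ := fun k => logTerm δ (Real.exp (k + 1)) with hLdef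
  set l : ℕ → ℝ := fun k => 1 / (2 * R + √(tangentPoint k / (2 * L k))) with hldef
  have hL : ∀ k, 0 < L k := fun k => logTerm_exp_pos hδ hδ1 k
  have htp : ∀ k, 0 < tangentPoint k := fun k => Real.exp_pos _
  have hr : ∀ k, 0 < √(tangentPoint k / (2 * L k)) := fun k =>
    Real.sqrt_pos.2 (div_pos (htp k) (by linarith [hL k]))
  have hden : ∀ k, 0 < 2 * R + √(tangentPoint k / (2 * L k)) := fun k => by linarith [hr k]
  have hlR : ∀ k, l k * (2 * R) < 1 := fun k => by
    rw [hldef, one_div_mul_eq_div, div_lt_one (hden k)]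
    linarith [hr k]
  have hsub : {ω | ∃ t, radius (2 * R) δ (max (Real.exp 1) (1 + empVar s e (history Z t ω))) <
      deviation env s (history Z t ω)} ⊆ ⋃ k, {ω | ∃ t, L k ≤ l k * deviation env s (history Z t ω) -
        l k ^ 2 / (2 * (1 - l k * (2 * R))) * empVar s e (history Z t ω)} := by
    rintro ω ⟨t, ht⟩
    obtain ⟨k, hk, hk1, hk2⟩ :=
      exists_tangentPoint (le_max_left (Real.exp 1) (1 + empVar s e (history Z t ω)))
    have hV : empVar s e (history Z t ω) ≤ max (Real.exp 1) (1 + empVar s e (history Z t ω)) :=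
      le_max_of_le_right (by linarith)
    have hn : 0 < max (Real.exp 1) (1 + empVar s e (history Z t ω)) :=
      lt_max_of_lt_left (Real.exp_pos 1)
    generalize max (Real.exp 1) (1 + empVar s e (history Z t ω)) = n at *
    refine Set.mem_iUnion.2 ⟨k, t, ?_⟩
    by_contra! hlt
    refine absurd ht (not_lt.2 ?_)
    have hmono : L k ≤ logTerm δ n := logTerm_mono (by rw [Real.one_lt_exp_iff]; positivity) hk
    have hLk := hL k
    calc deviation env s (history Z t ω) ≤ √(2.13 * n * L k) + 2 * R * L k :=
          le_of_line hLk (by positivity) hn (htp k) hk1 hk2 hV rfl hlt.le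
      _ ≤ radius (2 * R) δ n := by
          unfold radius
          have : 2 * R * L k ≤ 1.33 * (2 * R) * logTerm δ n := by
            have h0 : 0 ≤ 2 * R * logTerm δ n := mul_nonneg (by positivity) (hLk.le.trans hmono)
            have h1 : 2 * R * L k ≤ 2 * R * logTerm δ n := by gcongr
            linarith
          gcongr
          have h0 : 2.13 * n * L k ≤ 2.13 * n * logTerm δ n := by gcongr
          have h1 : 0 ≤ 1.76 * (2 * R * (2 * R)) * (logTerm δ n * logTerm δ n) :=
            mul_nonneg (by positivity) (mul_self_nonneg _)
          linarith
  calc _ ≤ ∑' k, μ {ω | ∃ t, L k ≤ l k * deviation env s (history Z t ω) -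
        l k ^ 2 / (2 * (1 - l k * (2 * R))) * empVar s e (history Z t ω)} :=
        (measure_mono hsub).trans (measure_iUnion_le _)
    _ ≤ ∑' k : ℕ, ENNReal.ofReal (Real.exp (-L k)) := ENNReal.tsum_le_tsum fun k =>
        hZ.measure_line_crossing_le hs he (one_div_pos.2 (hden k)).le (hlR k) _
    _ = _ := tsum_exp_neg_logTerm hδ

/-- The two-sided bound; the lower side is the upper side for `-s` and `-e`, which have the same
empirical variance. -/
theorem IsGeneratedBy.one_sub_le_measure_abs_deviation_le (hZ : IsGeneratedBy env μ Z)
    {s : List X → X → ℝ} {e : List X → ℝ} {R δ : ℝ} (hR : 0 ≤ R) (hs : ∀ h x, |s h x| ≤ R)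
    (he : ∀ h, |e h| ≤ R) (hδ : 0 < δ) (hδ1 : δ < 1) :
    ENNReal.ofReal (1 - δ) ≤ μ {ω | ∀ t, |deviation env s (history Z t ω)| ≤
      radius (2 * R) δ (max (Real.exp 1) (1 + empVar s e (history Z t ω)))} := by
  have hup := hZ.measure_radius_lt_deviation_le hR hs he hδ hδ1
  have hlo := hZ.measure_radius_lt_deviation_le (s := fun h x => -s h x) (e := fun h => -e h) hR
    (by simpa using hs) (by simpa using he) hδ hδ1
  have hvar : ∀ h, empVar (fun h x => -s h x) (fun h => -e h) h = empVar s e h := fun h => by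
    unfold empVar
    congr! 3
    ring
  simp only [hvar, deviation_neg] at hlo
  set G := {ω | ∀ t, |deviation env s (history Z t ω)| ≤
      radius (2 * R) δ (max (Real.exp 1) (1 + empVar s e (history Z t ω)))} with hG
  have hcompl : μ Gᶜ ≤ ENNReal.ofReal δ := by
    calc μ Gᶜ ≤ _ := measure_mono fun ω hω => ?_
      _ ≤ _ := measure_union_le _ _
      _ ≤ ENNReal.ofReal (δ / 2) + ENNReal.ofReal (δ / 2) := add_le_add hup hlo
      _ = ENNReal.ofReal δ := by
        rw [← ENNReal.ofReal_add (by positivity) (by positivity), add_halves]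
    simp only [hG, Set.mem_compl_iff, Set.mem_ofPred_eq, not_forall, not_le] at hω
    obtain ⟨t, ht⟩ := hω
    rcases lt_abs.1 ht with h | h
    · exact Or.inl ⟨t, h⟩
    · exact Or.inr ⟨t, h⟩
  -- Subadditivity suffices here: `G` is not known to be measurable.
  have huniv : 1 ≤ μ G + μ Gᶜ := by
    rw [← measure_univ (μ := μ), ← Set.union_compl_self G]
    exact measure_union_le _ _
  rw [ENNReal.ofReal_sub _ hδ.le, ENNReal.ofReal_one]
  exact tsub_le_iff_right.2 (huniv.trans (by gcongr))

end Stitching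

/-! ### The alignment scores as sums over the history -/

section Scores
variable {X Ω : Type*}

/-- The score difference `s` that the monitor reads when the state `x` follows the history `h`. -/
def scoreGap (ℓ : PMF X → X → ℝ) (model ref : List X → PMF X) (h : List X) (x : X) : ℝ :=
  ℓ (model h) x - ℓ (ref h) x

theorem abs_scoreGap_le {ℓ : PMF X → X → ℝ} {a b : ℝ} (hℓ : ∀ y x, ℓ y x ∈ Set.Icc a b)
    (model ref : List X → PMF X) (h : List X) (x : X) :
    |scoreGap ℓ model ref h x| ≤ b - a :=
  abs_sub_le_of_le_of_le (hℓ _ _).1 (hℓ _ _).2 (hℓ _ _).1 (hℓ _ _).2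

/-- `t` times the monitored quantity is the compensator of the sum of the observed score differences. -/
theorem mul_scoreDifference [Countable X] [MeasurableSpace X] [MeasurableSingletonClass X]
    {ℓ : PMF X → X → ℝ} {a b : ℝ} (hℓ : ∀ y x, ℓ y x ∈ Set.Icc a b)
    (env model ref : List X → PMF X) (Z : ℕ → Ω → X) {t : ℕ} (ht : 1 ≤ t) (ω : Ω) :
    t * scoreDifference (averageExpectedScore ℓ) (hiddenHistory env model ref Z t ω) =
      pathSum (scoreGap ℓ model ref) (history Z t ω) -
        deviation env (scoreGap ℓ model ref) (history Z t ω) := by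
  have ht0 : (t : ℝ) ≠ 0 := by positivity
  have hint : ∀ (p q : PMF X), Integrable (ℓ p) q.toMeasure := fun p q =>
    integrable_of_abs_le q (R := max |a| |b|) fun x => abs_le_max_abs_abs (hℓ p x).1 (hℓ p x).2
  have hsum : ∀ t : ℕ,
      (((hiddenHistory env model ref Z t ω).map fun h => (h.model, h.env)).map
        fun p => ∫ x, ℓ p.1 x ∂p.2.toMeasure).sum -
      (((hiddenHistory env model ref Z t ω).map fun h => (h.ref, h.env)).map
        fun p => ∫ x, ℓ p.1 x ∂p.2.toMeasure).sum =
      pathSum (scoreGap ℓ model ref) (history Z t ω) -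
        deviation env (scoreGap ℓ model ref) (history Z t ω) := by
    intro t
    induction t with
    | zero => simp [hiddenHistory, history_zero, deviation]
    | succ t ih =>
      have hs : hiddenHistory env model ref Z (t + 1) ω = hiddenHistory env model ref Z t ω ++
          [⟨model (history Z t ω), ref (history Z t ω), env (history Z t ω)⟩] := by
        simp [hiddenHistory, List.range_succ]
      have hi : ∫ x, scoreGap ℓ model ref (history Z t ω) x ∂(env (history Z t ω)).toMeasure =
          ∫ x, ℓ (model (history Z t ω)) x ∂(env (history Z t ω)).toMeasure -
            ∫ x, ℓ (ref (history Z t ω)) x ∂(env (history Z t ω)).toMeasure :=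
        integral_sub (hint _ _) (hint _ _)
      unfold deviation at ih ⊢
      rw [hs, history_succ, pathSum_concat, pathSum_concat, hi]
      simp only [List.map_append, List.sum_append, List.map_singleton, List.sum_singleton]
      linarith
  rw [← hsum t]
  have hlen : (hiddenHistory env model ref Z t ω).length = t := by simp [hiddenHistory]
  simp only [scoreDifference, averageExpectedScore, List.length_map, hlen]
  field_simp

end Scores

/-! ### The monitor computes the boundary -/

section Monitor
variable {X Ω : Type*}

theorem monitorConfig_concat (ℓ : PMF X → X → ℝ) (τ : PMF X → X → ℕ) (a b δ : ℝ)
    (w : List (Observed X)) (o : Observed X) :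
    monitorConfig ℓ τ a b δ (w ++ [o]) =
      (monitorConfig ℓ τ a b δ w).iterate (onInput ℓ o) (onInput τ o) nextProgram := by
  simp [monitorConfig]

theorem iterate_rT (oracle : Query → ℝ) (cost : Query → ℕ) (c : Config) :
    (c.iterate oracle cost nextProgram).mem rT = c.mem rT + 1 := rfl

theorem iterate_rN (oracle : Query → ℝ) (cost : Query → ℕ) (c : Config) :
    (c.iterate oracle cost nextProgram).mem rN =
      max 1 (c.mem rN + (oracle .model - oracle .reference - c.mem rE) *
        (oracle .model - oracle .reference - c.mem rE)) := rfl

theorem iterate_rE (oracle : Query → ℝ) (cost : Query → ℕ) (c : Config) :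
    (c.iterate oracle cost nextProgram).mem rE =
      1 / (c.mem rT + 1) * ((c.mem rT + 1 - 1) * c.mem rE +
        (oracle .model - oracle .reference)) := rfl

theorem iterate_rSigma (oracle : Query → ℝ) (cost : Query → ℕ) (c : Config) :
    (c.iterate oracle cost nextProgram).mem rSigma = c.mem rSigma := rfl

theorem iterate_rDelta (oracle : Query → ℝ) (cost : Query → ℕ) (c : Config) :
    (c.iterate oracle cost nextProgram).mem rDelta = c.mem rDelta := rfl

theorem iterate_rLo (oracle : Query → ℝ) (cost : Query → ℕ) (c : Config) :
    (c.iterate oracle cost nextProgram).mem rLo =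
      (c.iterate oracle cost nextProgram).mem rE -
        radius (c.mem rSigma) (c.mem rDelta)
          (max (Real.exp 1) ((c.iterate oracle cost nextProgram).mem rN)) /
            (c.iterate oracle cost nextProgram).mem rT := rfl

theorem iterate_rHi (oracle : Query → ℝ) (cost : Query → ℕ) (c : Config) :
    (c.iterate oracle cost nextProgram).mem rHi =
      (c.iterate oracle cost nextProgram).mem rE +
        radius (c.mem rSigma) (c.mem rDelta)
          (max (Real.exp 1) ((c.iterate oracle cost nextProgram).mem rN)) /
            (c.iterate oracle cost nextProgram).mem rT := rfl

theorem observedHistory_succ (model ref : List X → PMF X) (Z : ℕ → Ω → X) (t : ℕ) (ω : Ω) :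
    observedHistory model ref Z (t + 1) ω = observedHistory model ref Z t ω ++
      [⟨model (history Z t ω), ref (history Z t ω), Z t ω⟩] := by
  simp [observedHistory, List.range_succ]

/-- The registers at time `t`. The register `N` exceeds the empirical variance by exactly `1`: it
starts at `1`, and the maximum with `1` never takes effect. -/
theorem monitorConfig_mem (ℓ : PMF X → X → ℝ) (τ : PMF X → X → ℕ) (a b δ : ℝ)
    (model ref : List X → PMF X) (Z : ℕ → Ω → X) (t : ℕ) (ω : Ω) :
    let m := (monitorConfig ℓ τ a b δ (observedHistory model ref Z t ω)).mem
    let s := scoreGap ℓ model ref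
    m rT = t ∧ m rE = pathMean s (history Z t ω) ∧
      m rN = 1 + empVar s (pathMean s) (history Z t ω) ∧
      m rSigma = 2 * (b - a) ∧ m rDelta = δ := by
  intro m s
  induction t with
  | zero =>
    refine ⟨?_, ?_, ?_, rfl, rfl⟩ <;>
      simp [m, observedHistory, monitorConfig, initConfig, history_zero, pathMean, empVar]
  | succ t ih =>
    obtain ⟨hT, hE, hN, hS, hD⟩ := ih
    have hvar : 0 ≤ empVar s (pathMean s) (history Z t ω) :=
      pathSum_nonneg (fun h x => sq_nonneg _) _
    have hs : s (history Z t ω) (Z t ω) =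
        ℓ (model (history Z t ω)) (Z t ω) - ℓ (ref (history Z t ω)) (Z t ω) := rfl
    simp only [m, observedHistory_succ, monitorConfig_concat, iterate_rT, iterate_rE, iterate_rN,
      iterate_rSigma, iterate_rDelta, hT, hE, hN, hS, hD, onInput, history_succ, ← hs]
    refine ⟨by push_cast; rfl, ?_, ?_, trivial, trivial⟩
    · simp only [pathMean, pathSum_concat, List.length_append, length_history,
        List.length_singleton]
      rcases Nat.eq_zero_or_pos t with rfl | ht
      · simp [history_zero]
      · push_cast
        field_simp
        ring
    · have hsq := mul_self_nonneg (s (history Z t ω) (Z t ω) - pathMean s (history Z t ω))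
      rw [max_eq_right (by linarith)]
      simp only [empVar, pathSum_concat]
      ring

theorem diffMonitor_eq (ℓ : PMF X → X → ℝ) (τ : PMF X → X → ℕ) (a b δ : ℝ)
    (model ref : List X → PMF X) (Z : ℕ → Ω → X) {t : ℕ} (ht : 1 ≤ t) (ω : Ω) :
    diffMonitor ℓ τ a b δ (observedHistory model ref Z t ω) =
      let s := scoreGap ℓ model ref
      let ε := radius (2 * (b - a)) δ
        (max (Real.exp 1) (1 + empVar s (pathMean s) (history Z t ω))) / t
      Set.Icc (pathMean s (history Z t ω) - ε) (pathMean s (history Z t ω) + ε) := by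
  obtain ⟨t, rfl⟩ := Nat.exists_eq_add_of_le' ht
  obtain ⟨-, -, -, hS, hD⟩ := monitorConfig_mem ℓ τ a b δ model ref Z t ω
  obtain ⟨hT, hE, hN, -, -⟩ := monitorConfig_mem ℓ τ a b δ model ref Z (t + 1) ω
  rw [observedHistory_succ, monitorConfig_concat] at hT hE hN
  rw [observedHistory_succ, diffMonitor, monitorConfig_concat, iterate_rLo, iterate_rHi, hT, hE,
    hN, hS, hD]

theorem diffMonitor_sound [Countable X] [MeasurableSpace X] [MeasurableSingletonClass X]
    {ℓ : PMF X → X → ℝ} {a b δ : ℝ} (τ : PMF X → X → ℕ) (hℓ : ∀ y x, ℓ y x ∈ Set.Icc a b)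
    (hδ : 0 < δ) (hδ1 : δ < 1) [MeasurableSpace Ω] {μ : Measure Ω} [IsProbabilityMeasure μ]
    {env : List X → PMF X} (model ref : List X → PMF X) {Z : ℕ → Ω → X}
    (hZ : IsGeneratedBy env μ Z) :
    SolvesDifferentialMonitoring μ env model ref Z (averageExpectedScore ℓ) δ
      (diffMonitor ℓ τ a b δ) := by
  set s := scoreGap ℓ model ref with hsdef
  have hs : ∀ h x, |s h x| ≤ b - a := abs_scoreGap_le hℓ model ref
  -- The state space is nonempty because it carries the distribution `env []`.
  have hR : 0 ≤ b - a := by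
    obtain ⟨x, -⟩ := (env []).support_nonempty
    exact (abs_nonneg _).trans (hs [] x)
  refine (hZ.one_sub_le_measure_abs_deviation_le hR hs (abs_pathMean_le hR hs) hδ hδ1).trans
    (measure_mono fun ω hω t ht => ?_)
  have ht0 : (0 : ℝ) < t := by positivity
  have hdev := abs_le.1 (hω t)
  have hscore := mul_scoreDifference hℓ env model ref Z ht ω
  have hmean : t * pathMean s (history Z t ω) = pathSum s (history Z t ω) := by
    rw [pathMean, length_history]
    field_simp
  rw [← hsdef, ← hmean] at hscore
  rw [diffMonitor_eq ℓ τ a b δ model ref Z ht ω, ← hsdef]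
  simp only
  generalize radius _ _ _ = r at hdev ⊢
  have hr : t * (r / t) = r := by field_simp
  constructor
  · refine le_of_mul_le_mul_left ?_ ht0
    rw [mul_sub, hr, hscore]
    linarith
  · refine le_of_mul_le_mul_left ?_ ht0
    rw [mul_add, hr, hscore]
    linarith

end Monitor

/-! ### Time and space of one iteration -/

section Resources

theorem Config.foldl_step_space_le {oracle : Query → ℝ} {cost : Query → ℕ} {A : Finset Reg}
    {B : ℕ} {prog : List Assign}
    (hprog : ∀ s ∈ prog, s.dst ∈ A ∧ s.rhs.regs ⊆ A ∧ s.rhs.temps ≤ B) {c : Config}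
    (hc : c.used ⊆ A) (hs : c.space ≤ A.card + B) :
    (prog.foldl (Config.step oracle cost) c).used ⊆ A ∧
      (prog.foldl (Config.step oracle cost) c).space ≤ A.card + B := by
  induction prog generalizing c with
  | nil => exact ⟨hc, hs⟩
  | cons s prog ih =>
    obtain ⟨h1, h2, h3⟩ := hprog s (by simp)
    have hA : insert s.dst (c.used ∪ s.rhs.regs) ⊆ A :=
      Finset.insert_subset h1 (Finset.union_subset hc h2)
    exact ih (fun s' hs' => hprog s' (by simp [hs'])) hA
      (max_le hs (add_le_add (Finset.card_le_card hA) h3))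

theorem Config.foldl_step_time (oracle : Query → ℝ) (cost : Query → ℕ) (prog : List Assign)
    (c : Config) : (prog.foldl (Config.step oracle cost) c).time =
      c.time + (prog.map fun s => s.rhs.time cost + 1).sum := by
  induction prog generalizing c with
  | nil => simp
  | cons s prog ih =>
    simp only [List.foldl_cons, ih, List.map_cons, List.sum_cons, Config.step]
    ring

theorem Expr.add_def (e₁ e₂ : Expr) : e₁ + e₂ = .add e₁ e₂ := rfl

theorem Expr.sub_def (e₁ e₂ : Expr) : e₁ - e₂ = .sub e₁ e₂ := rfl

theorem Expr.mul_def (e₁ e₂ : Expr) : e₁ * e₂ = .mul e₁ e₂ := rfl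

theorem Expr.div_def (e₁ e₂ : Expr) : e₁ / e₂ = .div e₁ e₂ := rfl

theorem nextProgram_regs_temps : ∀ s ∈ nextProgram,
    s.dst ∈ Finset.range 11 ∧ s.rhs.regs ⊆ Finset.range 11 ∧ s.rhs.temps ≤ 5 := by
  simp only [nextProgram, List.forall_mem_cons, Expr.add_def, Expr.sub_def, Expr.mul_def,
    Expr.div_def, Expr.regs, Expr.temps]
  refine ⟨by decide, by decide, by decide, by decide, by decide, by decide, by decide, by decide,
    by decide, by simp⟩

variable {X : Type*}

theorem monitorConfig_space_le (ℓ : PMF X → X → ℝ) (τ : PMF X → X → ℕ) (a b δ : ℝ)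
    (w : List (Observed X)) :
    (monitorConfig ℓ τ a b δ w).used ⊆ Finset.range 11 ∧
      (monitorConfig ℓ τ a b δ w).space ≤ 16 := by
  induction w using List.reverseRecOn with
  | nil => exact ⟨(by decide : ({rT, rE, rN, rSigma, rDelta} : Finset Reg) ⊆ Finset.range 11),
      (by decide : 5 ≤ 16)⟩
  | append_singleton w o ih =>
    rw [monitorConfig_concat]
    exact Config.foldl_step_space_le (B := 5) nextProgram_regs_temps ih.1 (Nat.zero_le _)

theorem iterate_time (oracle : Query → ℝ) (cost : Query → ℕ) (c : Config) :
    (c.iterate oracle cost nextProgram).time = cost .model + cost .reference + 83 := by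
  rw [Config.iterate, Config.foldl_step_time]
  simp only [nextProgram, List.map_cons, List.map_nil, List.sum_cons, List.sum_nil, Expr.add_def,
    Expr.sub_def, Expr.mul_def, Expr.div_def, Expr.time]
  ring

end Resources
end AlignmentMonitoring

theorem theorem2 :
    ∃ C : ℕ, ∀ (X : Type*) [Countable X] [MeasurableSpace X] [MeasurableSingletonClass X]
      (ℓ : PMF X → X → ℝ) (a b δ : ℝ) (τ : PMF X → X → ℕ),
      (∀ y x, ℓ y x ∈ Set.Icc a b) → 0 < δ → δ < 1 →
      -- soundness
      (∀ (Ω : Type*) [MeasurableSpace Ω] (μ : Measure Ω) [IsProbabilityMeasure μ]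
        (env model ref : List X → PMF X) (Z : ℕ → Ω → X),
        AlignmentMonitoring.IsGeneratedBy env μ Z →
        AlignmentMonitoring.SolvesDifferentialMonitoring μ env model ref Z
          (AlignmentMonitoring.averageExpectedScore ℓ) δ
          (AlignmentMonitoring.diffMonitor ℓ τ a b δ)) ∧
      -- space and time of the iteration that processes `o` after the history `w`
      (∀ (w : List (AlignmentMonitoring.Observed X)) (o : AlignmentMonitoring.Observed X),
        (AlignmentMonitoring.monitorConfig ℓ τ a b δ (w ++ [o])).space ≤ C ∧
        ∀ T : ℕ, 1 ≤ T → (∀ y x, τ y x ≤ T) →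
          (AlignmentMonitoring.monitorConfig ℓ τ a b δ (w ++ [o])).time ≤ C * T) := by
  refine ⟨85, fun X _ _ _ ℓ a b δ τ hℓ hδ hδ1 => ⟨fun Ω _ μ _ env model ref Z hZ =>
    AlignmentMonitoring.diffMonitor_sound τ hℓ hδ hδ1 model ref hZ, fun w o => ⟨?_, ?_⟩⟩⟩
  · exact (AlignmentMonitoring.monitorConfig_space_le ℓ τ a b δ _).2.trans (by norm_num)
  · intro T hT hτ
    rw [AlignmentMonitoring.monitorConfig_concat, AlignmentMonitoring.iterate_time]
    have h1 := hτ o.model o.state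
    have h2 := hτ o.ref o.state
    simp only [AlignmentMonitoring.onInput]
    omega
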